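/- For an infinite word $\mathbf u=u_0u_1u_2\cdots$ and $n\in\mathbb N$, the initial non-repetitive complexity is $$inr\mathcal C_{\mathbf u}(n):=\max\{m\in\mathbb N:\ u_i\cdots u_{i+n-1}\neq u_j\cdots u_{j+n-1}\ \text{ for all } i,j \text{ with } 0\le i<j\le m-1\}.$$ Let $\mathbf f$ be the Fibonacci word, i.e. the unique infinite word over $\{0,1\}$ fixed by the morphism $0\mapsto 01,\ 1\mapsto 0$, and let $\mathbf t$ be the Tribonacci word, i.e. the unique infinite word over $\{0,1,2\}$ fixed by the morphism $0\mapsto 01,\ 1\mapsto 02,\ 2\mapsto 0$. Let $F_0=1$, $F_1=2$, $F_k=F_{k-1}+F_{k-2}$ for $k\ge 2$ (Fibonacci numbers) and $T_{-1}=1$, $T_0=1$, $T_1=2$, $T_2=4$, $T_k=T_{k-1}+T_{k-2}+T_{k-3}$ for $k\ge 3$ (Tribonacci numbers). (i) If $n,k$ are positive integers with $F_k-2<n\le F_{k+1}-2$, then $inr\mathcal C_{\mathbf f}(n)=F_k$. (ii) If $n,k$ are positive integers with $\frac{T_k+T_{k-2}-3}{2}<n\le\frac{T_{k+1}+T_{k-1}-3}{2}$,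 then $inr\mathcal C_{\mathbf t}(n)=T_k$. In both cases the maximum defining $inr\mathcal C$ exists. -/

import Mathlib

/-! Infinite words over `A` are functions `ℕ → A`; finite words are lists. -/

/-- The factor `u_i u_{i+1} ⋯ u_{i+n-1}` of length `n` occurring in `u` at position `i`. -/
def factorAt {A : Type*} (u : ℕ → A) (n i : ℕ) : List A :=
  (List.range n).map fun l => u (i + l)

/-- The set of all `m` such that the factors of length `n` at the positions
`0, 1, …, m - 1` of `u` are pairwise distinct. -/
def initialNonrepetitive {A : Type*} (u : ℕ → A) (n : ℕ) : Set ℕ :=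
  {m | ∀ i j : ℕ, i < j → j < m → factorAt u n i ≠ factorAt u n j}

/-- The initial non-repetitive complexity: the maximum of `initialNonrepetitive u n`
(meaningful when this set has a greatest element). -/
noncomputable def inrC {A : Type*} (u : ℕ → A) (n : ℕ) : ℕ :=
  sSup (initialNonrepetitive u n)

/-- The morphism of the free monoid of finite words that is given by its values on letters. -/
def applyMorphism {A : Type*} (ψ : A → List A) (w : List A) : List A := w.flatMap ψ

/-- The prefix of length `n` of an infinite word. -/
def prefixOf {A : Type*} (u : ℕ → A) (n : ℕ) : List A := (List.range n).map u

/-- `u = ψ(u_0) ψ(u_1) ψ(u_2) ⋯` for a morphism `ψ` for which no letter has an empty image: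
no image is empty and every word `ψ(u_0 ⋯ u_{n-1})` is a prefix of `u`. -/
def IsFixedPointOf {A : Type*} (ψ : A → List A) (u : ℕ → A) : Prop :=
  (∀ b, ψ b ≠ []) ∧
    ∀ n, applyMorphism ψ (prefixOf u n) = prefixOf u (applyMorphism ψ (prefixOf u n)).length

/-- The finite word `ψ^n(a)`. -/
def iterMorphism {A : Type*} (ψ : A → List A) (a : A) (n : ℕ) : List A :=
  (applyMorphism ψ)^[n] [a]

/-- The limit of the finite words `ψ^n(a)`: its letter at position `i` is that of `ψ^i(a)`.
(The default value `a` is never used for the two morphisms below.) -/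
def limitWord {A : Type*} (ψ : A → List A) (a : A) : ℕ → A :=
  fun i => (iterMorphism ψ a i).getD i a

/-- The Fibonacci morphism `0 → 01`, `1 → 0`. -/
def fibMorphism : Fin 2 → List (Fin 2) := ![[0, 1], [0]]

/-- The Tribonacci morphism `0 → 01`, `1 → 02`, `2 → 0`. -/
def tribMorphism : Fin 3 → List (Fin 3) := ![[0, 1], [0, 2], [0]]

/-- The Fibonacci word `0100101001001⋯`; see `fibWord_isFixedPointOf` and `fibWord_unique`. -/
def fibWord : ℕ → Fin 2 := limitWord fibMorphism 0

/-- The Tribonacci word `0102010010201⋯`; see `tribWord_isFixedPointOf` and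
`tribWord_unique`. -/
def tribWord : ℕ → Fin 3 := limitWord tribMorphism 0

/-- The Fibonacci numbers, indexed so that `F_0 = 1`, `F_1 = 2`, `F_k = F_{k-1} + F_{k-2}`. -/
def fibNum (k : ℕ) : ℕ := Nat.fib (k + 2)

/-- The Tribonacci numbers with nonnegative index: `T_0 = 1`, `T_1 = 2`, `T_2 = 4`,
`T_k = T_{k-1} + T_{k-2} + T_{k-3}`. -/
def tribNumNat : ℕ → ℕ
  | 0 => 1
  | 1 => 2
  | 2 => 4
  | k + 3 => tribNumNat (k + 2) + tribNumNat (k + 1) + tribNumNat k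

/-- The Tribonacci numbers, extended to negative indices by `T_{-1} = 1` and
`T_{-2} = T_{-3} = ⋯ = 0`. -/
def tribNum : ℤ → ℕ
  | Int.ofNat k => tribNumNat k
  | Int.negSucc 0 => 1
  | Int.negSucc (_ + 1) => 0

/-! The two words are the unique fixed points of their morphisms. -/

theorem prefixOf_length {A : Type*} (u : ℕ → A) (n : ℕ) : (prefixOf u n).length = n := by
  simp [prefixOf]

theorem eq_prefixOf_of_prefix {A : Type*} {u : ℕ → A} {w : List A} {n : ℕ}
    (h : w <+: prefixOf u n) : w = prefixOf u w.length := by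
  have hl := h.length_le
  rw [prefixOf_length] at hl
  have h1 := List.prefix_iff_eq_take.1 h
  rw [prefixOf, ← List.map_take, List.take_range, min_eq_left hl] at h1
  exact h1

theorem prefixOf_prefix {A : Type*} (u : ℕ → A) {m n : ℕ} (h : m ≤ n) :
    prefixOf u m <+: prefixOf u n := by
  have : prefixOf u m = (prefixOf u n).take m := by
    rw [prefixOf, prefixOf, ← List.map_take, List.take_range, min_eq_left h]
  rw [this]
  exact List.take_prefix _ _

theorem applyMorphism_prefix {A : Type*} (ψ : A → List A) {v w : List A} (h : v <+: w) :
    applyMorphism ψ v <+: applyMorphism ψ w := by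
  obtain ⟨s, rfl⟩ := h
  exact ⟨applyMorphism ψ s, by simp [applyMorphism]⟩

theorem iterMorphism_succ {A : Type*} (ψ : A → List A) (a : A) (n : ℕ) :
    iterMorphism ψ a (n + 1) = applyMorphism ψ (iterMorphism ψ a n) := by
  simp [iterMorphism, Function.iterate_succ_apply']

theorem length_le_applyMorphism {A : Type*} {ψ : A → List A} (hψ : ∀ b, ψ b ≠ [])
    (w : List A) : w.length ≤ (applyMorphism ψ w).length := by
  induction w with
  | nil => simp
  | cons b w ih =>
    have := List.length_pos_iff.2 (hψ b)
    simp only [applyMorphism, List.flatMap_cons, List.length_append, List.length_cons] at ih ⊢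
    omega

theorem iterMorphism_succ_eq {A : Type*} {ψ : A → List A} (hψ : ∀ b, ψ b ≠ []) {a : A}
    {s : List A} (ha : ψ a = a :: s) (hs : s ≠ []) (n : ℕ) :
    ∃ t, t ≠ [] ∧ iterMorphism ψ a (n + 1) = iterMorphism ψ a n ++ t := by
  induction n with
  | zero => exact ⟨s, hs, by simp [iterMorphism, applyMorphism, ha]⟩
  | succ n ih =>
    obtain ⟨t, ht, h⟩ := ih
    refine ⟨applyMorphism ψ t, ?_, ?_⟩
    · have h1 := length_le_applyMorphism hψ t
      have h2 := List.length_pos_iff.2 ht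
      exact List.length_pos_iff.1 (by omega)
    · calc iterMorphism ψ a (n + 1 + 1)
          = applyMorphism ψ (iterMorphism ψ a n ++ t) := by rw [iterMorphism_succ, h]
        _ = applyMorphism ψ (iterMorphism ψ a n) ++ applyMorphism ψ t := by
            simp [applyMorphism]
        _ = iterMorphism ψ a (n + 1) ++ applyMorphism ψ t := by rw [← iterMorphism_succ]

theorem lt_length_iterMorphism {A : Type*} {ψ : A → List A} (hψ : ∀ b, ψ b ≠ []) {a : A}
    {s : List A} (ha : ψ a = a :: s) (hs : s ≠ []) (n : ℕ) :
    n < (iterMorphism ψ a n).length := by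
  induction n with
  | zero => simp [iterMorphism]
  | succ n ih =>
    obtain ⟨t, ht, h⟩ := iterMorphism_succ_eq hψ ha hs n
    have := List.length_pos_iff.2 ht
    rw [h, List.length_append]
    omega

theorem iterMorphism_prefix {A : Type*} {ψ : A → List A} (hψ : ∀ b, ψ b ≠ []) {a : A}
    {s : List A} (ha : ψ a = a :: s) (hs : s ≠ []) {m n : ℕ} (hmn : m ≤ n) :
    iterMorphism ψ a m <+: iterMorphism ψ a n := by
  induction n, hmn using Nat.le_induction with
  | base => exact List.prefix_rfl
  | succ n _ ih =>
    obtain ⟨t, _, h⟩ := iterMorphism_succ_eq hψ ha hs n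
    exact ih.trans ⟨t, h.symm⟩

theorem iterMorphism_eq_prefixOf {A : Type*} {ψ : A → List A} (hψ : ∀ b, ψ b ≠ []) {a : A}
    {s : List A} (ha : ψ a = a :: s) (hs : s ≠ []) (n : ℕ) :
    iterMorphism ψ a n = prefixOf (limitWord ψ a) (iterMorphism ψ a n).length := by
  apply List.ext_getElem
  · rw [prefixOf_length]
  · intro i h1 h2
    have h3 := lt_length_iterMorphism hψ ha hs i
    have h4 : limitWord ψ a i = (iterMorphism ψ a i)[i] := by
      simp [limitWord, List.getD_eq_getElem?_getD, List.getElem?_eq_getElem h3]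
    simp only [prefixOf, List.getElem_map, List.getElem_range]
    rw [h4]
    rcases le_total n i with h | h
    · exact (iterMorphism_prefix hψ ha hs h).getElem h1
    · exact ((iterMorphism_prefix hψ ha hs h).getElem h3).symm

theorem limitWord_isFixedPointOf {A : Type*} {ψ : A → List A} (hψ : ∀ b, ψ b ≠ []) {a : A}
    {s : List A} (ha : ψ a = a :: s) (hs : s ≠ []) : IsFixedPointOf ψ (limitWord ψ a) := by
  refine ⟨hψ, fun n => ?_⟩
  have h1 : prefixOf (limitWord ψ a) n <+: iterMorphism ψ a n := by
    rw [iterMorphism_eq_prefixOf hψ ha hs n]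
    exact prefixOf_prefix _ (lt_length_iterMorphism hψ ha hs n).le
  have h2 := applyMorphism_prefix ψ h1
  rw [← iterMorphism_succ, iterMorphism_eq_prefixOf hψ ha hs (n + 1)] at h2
  exact eq_prefixOf_of_prefix h2

theorem eq_limitWord {A : Type*} {ψ : A → List A} {a : A} {s : List A} (ha : ψ a = a :: s)
    (hs : s ≠ []) {v : ℕ → A} (hv : IsFixedPointOf ψ v) (h0 : v 0 = a) :
    v = limitWord ψ a := by
  have key : ∀ n, iterMorphism ψ a n = prefixOf v (iterMorphism ψ a n).length := by
    intro n
    induction n with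
    | zero => simp [iterMorphism, prefixOf, h0]
    | succ n ih =>
      rw [iterMorphism_succ, ih]
      exact hv.2 _
  funext i
  have h3 := lt_length_iterMorphism hv.1 ha hs i
  have h4 : limitWord ψ a i = (iterMorphism ψ a i)[i] := by
    simp [limitWord, List.getD_eq_getElem?_getD, List.getElem?_eq_getElem h3]
  rw [h4, List.getElem_of_eq (key i) h3]
  simp [prefixOf]

theorem fixedPoint_apply_zero {A : Type*} {ψ : A → List A} {a : A}
    (hψ : ∀ b, (ψ b).head? = some a) {v : ℕ → A} (hv : IsFixedPointOf ψ v) : v 0 = a := by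
  have h := hv.2 1
  have h1 : applyMorphism ψ (prefixOf v 1) = ψ (v 0) := by
    simp [applyMorphism, prefixOf, List.range_one]
  rw [h1] at h
  have h2 := hψ (v 0)
  rw [h] at h2
  have h3 := List.length_pos_iff.2 (hv.1 (v 0))
  simpa [prefixOf, List.head?_range, h3.ne'] using h2

/-- The Fibonacci word is a fixed point of the Fibonacci morphism. -/
theorem fibWord_isFixedPointOf : IsFixedPointOf fibMorphism fibWord :=
  limitWord_isFixedPointOf (s := [1]) (by decide) rfl (by simp)

/-- The Fibonacci morphism has no other fixed point. -/
theorem fibWord_unique {v : ℕ → Fin 2} (hv : IsFixedPointOf fibMorphism v) : v = fibWord :=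
  eq_limitWord (s := [1]) rfl (by simp) hv (fixedPoint_apply_zero (by decide) hv)

/-- The Tribonacci word is a fixed point of the Tribonacci morphism. -/
theorem tribWord_isFixedPointOf : IsFixedPointOf tribMorphism tribWord :=
  limitWord_isFixedPointOf (s := [1]) (by decide) rfl (by simp)

/-- The Tribonacci morphism has no other fixed point. -/
theorem tribWord_unique {v : ℕ → Fin 3} (hv : IsFixedPointOf tribMorphism v) :
    v = tribWord :=
  eq_limitWord (s := [1]) rfl (by simp) hv (fixedPoint_apply_zero (by decide) hv)

/-! Both morphisms have the form `b ↦ z σ(b)`, shortened to `z` when `σ b = z`, with `σ` a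
bijection. Let `T k` be the length of the `k`-th iterated image of `z`, and let `M 0 = 0`, `M (k +
1) = pos (M k) + 1`. Upper bound: if a prefix recurs at `T`, its image followed by `z` recurs at
`pos T` (`agree_pos`), so the prefix of length `M k` recurs at `T k`. Lower bound: equal factors at
distinct positions below `T (k + 1)` have length at most `M k`. Such a pair desubstitutes to a pair
below `T k`, and a maximal common factor starting at block starts is an image followed by `z`. A
bound on the length of a factor does not control the length of its image, so the induction compares
the counts of every letter with those of the prefix of length `M k` (`letterCount_le_step`). Hence
the complexity is `T (k + 1)` for `M k < n ≤ M (k + 1)`; letter counts also give the recurrences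
that identify `T` and `M`. -/

/-- The word `u` is the concatenation of blocks that start at the positions `pos 0 = 0, pos 1, …`;
the block number `m` is `z` if `σ (u m) = z`, and it consists of the two letters `z` and `σ (u m)`
otherwise. -/
structure IsSelfCoding {A : Type*} [DecidableEq A] (u : ℕ → A) (z : A) (σ : A → A)
    (pos : ℕ → ℕ) : Prop where
  bijective : Function.Bijective σ
  pos_zero : pos 0 = 0
  pos_succ : ∀ m, pos (m + 1) = pos m + if σ (u m) = z then 1 else 2
  apply_pos : ∀ m, u (pos m) = z
  apply_pos_succ : ∀ m, u (pos m + 1) = σ (u m)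

theorem prefixOf_succ {A : Type*} (u : ℕ → A) (m : ℕ) :
    prefixOf u (m + 1) = prefixOf u m ++ [u m] := by
  simp [prefixOf, List.range_succ]

theorem prefixOf_getElem? {A : Type*} (u : ℕ → A) {m i : ℕ} (h : i < m) :
    (prefixOf u m)[i]? = some (u i) := by
  simp [prefixOf, h]

/-- A fixed point of a morphism `a ↦ z σ(a)` (or `a ↦ z` if `σ a = z`) codes itself. -/
theorem IsFixedPointOf.isSelfCoding {A : Type*} [DecidableEq A] {ψ : A → List A} {u : ℕ → A}
    (hu : IsFixedPointOf ψ u) {z : A} {σ : A → A} (hσ : Function.Bijective σ)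
    (hψ : ∀ b, ψ b = z :: if σ b = z then [] else [σ b]) :
    IsSelfCoding u z σ fun m => (applyMorphism ψ (prefixOf u m)).length := by
  have app : ∀ m, applyMorphism ψ (prefixOf u (m + 1)) =
      applyMorphism ψ (prefixOf u m) ++ ψ (u m) := by
    intro m
    simp [prefixOf_succ, applyMorphism]
  have succ : ∀ m, (applyMorphism ψ (prefixOf u (m + 1))).length =
      (applyMorphism ψ (prefixOf u m)).length + if σ (u m) = z then 1 else 2 := by
    intro m
    rw [app, List.length_append, hψ]
    split_ifs <;> simp
  have letter : ∀ m l, l < (ψ (u m)).length →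
      some (u ((applyMorphism ψ (prefixOf u m)).length + l)) = (ψ (u m))[l]? := by
    intro m l hl
    have h1 : (applyMorphism ψ (prefixOf u m)).length + l <
        (applyMorphism ψ (prefixOf u (m + 1))).length := by
      rw [app, List.length_append]
      omega
    rw [← prefixOf_getElem? u h1, ← hu.2 (m + 1), app,
      List.getElem?_append_right (Nat.le_add_right _ _), Nat.add_sub_cancel_left]
  have start : ∀ m, u (applyMorphism ψ (prefixOf u m)).length = z := by
    intro m
    have h := letter m 0 (by simp [hψ])
    simpa [hψ] using h
  refine ⟨hσ, by simp [prefixOf, applyMorphism], succ, start, fun m => ?_⟩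
  -- After a one-letter block the next position starts a new block, whose letter `z` is again `σ (u
  -- m)`.
  by_cases h : σ (u m) = z
  · have h1 := start (m + 1)
    rwa [succ, if_pos h, ← h] at h1
  · have h1 := letter m 1 (by simp [hψ, h])
    simpa [hψ, h] using h1

theorem factorAt_eq_iff {A : Type*} {u : ℕ → A} {n i j : ℕ} :
    factorAt u n i = factorAt u n j ↔ ∀ l < n, u (i + l) = u (j + l) := by
  simp [factorAt]

/-! ### Letter counts of prefixes -/

/-- The number of occurrences of `a` among the first `n` letters of `u`. -/
def letterCount {A : Type*} [DecidableEq A] (u : ℕ → A) (a : A) (n : ℕ) : ℕ :=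
  Nat.count (fun l => u l = a) n

section LetterCount

variable {A : Type*} [DecidableEq A] (u : ℕ → A)

theorem letterCount_zero (a : A) : letterCount u a 0 = 0 := Nat.count_zero _

theorem letterCount_succ (a : A) (n : ℕ) :
    letterCount u a (n + 1) = letterCount u a n + if u n = a then 1 else 0 :=
  Nat.count_succ _ _

theorem letterCount_mono (a : A) : Monotone (letterCount u a) := Nat.count_monotone _

theorem sum_letterCount [Fintype A] (n : ℕ) : ∑ a, letterCount u a n = n := by
  induction n with
  | zero => simp [letterCount_zero]
  | succ n ih => simp [letterCount_succ, Finset.sum_add_distrib, ih]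

end LetterCount

/-! ### Desubstitution and repetitions in self-coding words -/

namespace IsSelfCoding

variable {A : Type*} [DecidableEq A] {u : ℕ → A} {z : A} {σ : A → A} {pos : ℕ → ℕ}

theorem strictMono (h : IsSelfCoding u z σ pos) : StrictMono pos := by
  refine strictMono_nat_of_lt_succ fun m => ?_
  rw [h.pos_succ]
  split_ifs <;> omega

/-- The condition `u i ≠ z` makes the alternatives exclusive: block starts are exactly the
occurrences of `z`, so equal letters occupy the same place in their blocks. -/
theorem exists_eq_pos_or (h : IsSelfCoding u z σ pos) (i : ℕ) :
    ∃ m, i = pos m ∨ i = pos m + 1 ∧ u i ≠ z := by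
  induction i with
  | zero => exact ⟨0, Or.inl h.pos_zero.symm⟩
  | succ i ih =>
    obtain ⟨m, rfl | ⟨rfl, hi⟩⟩ := ih
    · by_cases hz : σ (u m) = z
      · exact ⟨m + 1, Or.inl (by rw [h.pos_succ, if_pos hz])⟩
      · exact ⟨m, Or.inr ⟨rfl, by rwa [h.apply_pos_succ]⟩⟩
    · rw [h.apply_pos_succ] at hi
      exact ⟨m + 1, Or.inl (by rw [h.pos_succ, if_neg hi])⟩

/-- The length of a block depends only on the letter it codes, so equal factors have images of equal
length. -/
theorem pos_add_eq (h : IsSelfCoding u z σ pos) {i j m : ℕ}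
    (hm : ∀ l < m, u (i + l) = u (j + l)) : pos (i + m) + pos j = pos (j + m) + pos i := by
  induction m with
  | zero => simp [add_comm]
  | succ m ih =>
    have h1 := ih fun l hl => hm l (by omega)
    rw [← add_assoc, ← add_assoc, h.pos_succ, h.pos_succ, hm m (by omega)]
    omega

theorem letterCount_pos_self (h : IsSelfCoding u z σ pos) (m : ℕ) :
    letterCount u z (pos m) = m := by
  induction m with
  | zero => simp [h.pos_zero, letterCount_zero]
  | succ m ih =>
    rw [h.pos_succ]
    split_ifs with hz
    · rw [letterCount_succ, if_pos (h.apply_pos m), ih]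
    · rw [letterCount_succ, letterCount_succ, if_pos (h.apply_pos m), ih, h.apply_pos_succ,
        if_neg hz]

/-- By injectivity of `σ`, a letter `σ b ≠ z` occurs only in the blocks coding `b`, once in each. -/
theorem letterCount_pos (h : IsSelfCoding u z σ pos) {b : A} (hb : σ b ≠ z) (m : ℕ) :
    letterCount u (σ b) (pos m) = letterCount u b m := by
  induction m with
  | zero => simp [h.pos_zero, letterCount_zero]
  | succ m ih =>
    rw [h.pos_succ, letterCount_succ u b]
    split_ifs with hz hm hm
    · exact absurd (hm ▸ hz) hb
    · rw [letterCount_succ, h.apply_pos, if_neg hb.symm, ih]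
    · rw [letterCount_succ, letterCount_succ, h.apply_pos, if_neg hb.symm, ih, h.apply_pos_succ,
        hm, if_pos rfl]
    · rw [letterCount_succ, letterCount_succ, h.apply_pos, if_neg hb.symm, ih, h.apply_pos_succ,
        if_neg (fun e => hm (h.bijective.1 e))]

theorem letterCount_pos_add_one_self (h : IsSelfCoding u z σ pos) (m : ℕ) :
    letterCount u z (pos m + 1) = m + 1 := by
  rw [letterCount_succ, h.letterCount_pos_self, if_pos (h.apply_pos m)]

theorem letterCount_pos_add_one (h : IsSelfCoding u z σ pos) {b : A} (hb : σ b ≠ z) (m : ℕ) :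
    letterCount u (σ b) (pos m + 1) = letterCount u b m := by
  rw [letterCount_succ, h.letterCount_pos hb, h.apply_pos, if_neg hb.symm]
  rfl

/-- The images of two equal factors, extended by the letter `z`, are equal. -/
theorem agree_pos (h : IsSelfCoding u z σ pos) {T M : ℕ} (hM : ∀ l < M, u l = u (T + l)) :
    ∀ p < pos M + 1, u p = u (pos T + p) := by
  have hpos : ∀ l ≤ M, pos (T + l) = pos T + pos l := by
    intro l hl
    have := h.pos_add_eq (i := T) (j := 0) (m := l) fun l' hl' => by
      rw [zero_add]
      exact (hM l' (by omega)).symm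
    rw [zero_add, h.pos_zero] at this
    omega
  intro p hp
  obtain ⟨m, rfl | ⟨rfl, -⟩⟩ := h.exists_eq_pos_or p
  · have hm : m ≤ M := h.strictMono.le_iff_le.1 (by omega)
    rw [← hpos m hm, h.apply_pos, h.apply_pos]
  · have hm : m < M := h.strictMono.lt_iff_lt.1 (by omega)
    rw [← add_assoc, ← hpos m hm.le, h.apply_pos_succ, h.apply_pos_succ, hM m hm]

/-- If equal factors that start at distinct positions below `T` have at most as many occurrences
of each letter as the prefix of length `M`, then the same holds for `pos T` and `pos M + 1`. -/
theorem letterCount_le_step [Fintype A] (h : IsSelfCoding u z σ pos) {T M : ℕ}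
    (hT : ∀ i j n, i < j → j < T → (∀ l < n, u (i + l) = u (j + l)) →
      ∀ a, letterCount u a (i + n) ≤ letterCount u a i + letterCount u a M)
    {i j n : ℕ} (hij : i < j) (hj : j < pos T) (hn : ∀ l < n, u (i + l) = u (j + l)) (a : A) :
    letterCount u a (i + n) ≤ letterCount u a i + letterCount u a (pos M + 1) := by
  -- The case where both factors start at block starts; the general case reduces to it.
  have key : ∀ i j n, i < j → j < T → (∀ l < n, u (pos i + l) = u (pos j + l)) →
      letterCount u a (pos i + n) ≤ letterCount u a (pos i) + letterCount u a (pos M + 1) := by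
    intro i j n hij hj hn
    have bound : ∀ n, (∀ l < n, u (i + l) = u (j + l)) → n ≤ M := by
      intro n hn
      have h1 := Finset.sum_le_sum fun a (_ : a ∈ Finset.univ) => hT i j n hij hj hn a
      rw [Finset.sum_add_distrib, sum_letterCount, sum_letterCount, sum_letterCount] at h1
      omega
    have ex : ∃ m, u (i + m) ≠ u (j + m) := by
      by_contra! hc
      have := bound (M + 1) fun l _ => hc l
      omega
    obtain ⟨m, hm, hmin⟩ : ∃ m, u (i + m) ≠ u (j + m) ∧ ∀ l < m, u (i + l) = u (j + l) :=
      ⟨Nat.find ex, Nat.find_spec ex, fun l hl => not_not.1 (Nat.find_min ex hl)⟩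
    -- With `m` the first mismatch of the coded words, the images agree up to and including the next
    -- `z`; the letters after it are images under `σ` of different letters, hence differ.
    have hle : pos i + n ≤ pos (i + m) + 1 := by
      by_contra! hc
      have h1 := h.pos_add_eq hmin
      have h2 : pos i ≤ pos (i + m) := h.strictMono.monotone (Nat.le_add_right _ _)
      have h3 := hn (pos (i + m) + 1 - pos i) (by omega)
      rw [show pos i + (pos (i + m) + 1 - pos i) = pos (i + m) + 1 by omega,
        show pos j + (pos (i + m) + 1 - pos i) = pos (j + m) + 1 by omega,
        h.apply_pos_succ, h.apply_pos_succ] at h3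
      exact hm (h.bijective.1 h3)
    refine (letterCount_mono u a hle).trans ?_
    obtain ⟨b, rfl⟩ := h.bijective.2 a
    -- Occurrences of `z` count blocks, so they are bounded through the length `m ≤ M`; any other
    -- letter uses the count of its preimage.
    by_cases hb : σ b = z
    · have := bound m hmin
      rw [hb, h.letterCount_pos_add_one_self, h.letterCount_pos_add_one_self,
        h.letterCount_pos_self]
      omega
    · rw [h.letterCount_pos_add_one hb, h.letterCount_pos_add_one hb, h.letterCount_pos hb]
      exact hT i j m hij hj hmin b
  rcases n with _ | n
  · simp
  have hz : u i = u j := hn 0 (by omega)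
  obtain ⟨i', rfl | ⟨rfl, hi⟩⟩ := h.exists_eq_pos_or i
  · obtain ⟨j', rfl | ⟨rfl, hj'⟩⟩ := h.exists_eq_pos_or j
    · exact key i' j' _ (h.strictMono.lt_iff_lt.1 hij) (h.strictMono.lt_iff_lt.1 hj) hn
    · exact absurd (hz.symm.trans (h.apply_pos i')) hj'
  · obtain ⟨j', rfl | ⟨rfl, hj'⟩⟩ := h.exists_eq_pos_or j
    · exact absurd (hz.trans (h.apply_pos j')) hi
    · have h1 := key i' j' (n + 2) (h.strictMono.lt_iff_lt.1 (by omega))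
        (h.strictMono.lt_iff_lt.1 (by omega)) (by
          rintro (_ | l) hl
          · exact (h.apply_pos i').trans (h.apply_pos j').symm
          · have := hn l (by omega)
            rwa [add_assoc, add_assoc, add_comm 1 l] at this)
      have h2 := letterCount_mono u a (Nat.le_add_right (pos i') 1)
      rw [show pos i' + 1 + (n + 1) = pos i' + (n + 2) by omega]
      omega

/-- The initial non-repetitive complexity of a self-coding word. -/
theorem isGreatest_initialNonrepetitive [Fintype A] (h : IsSelfCoding u z σ pos)
    (hz : σ z ≠ z) {T M : ℕ → ℕ} (hT0 : T 0 = 1) (hT : ∀ k, T (k + 1) = pos (T k))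
    (hM0 : M 0 = 0) (hM : ∀ k, M (k + 1) = pos (M k) + 1) {n k : ℕ} (h1 : M k < n)
    (h2 : n ≤ M (k + 1)) :
    IsGreatest (initialNonrepetitive u n) (T (k + 1)) := by
  have period : ∀ k, ∀ l < M k, u l = u (T k + l) := by
    intro k
    induction k with
    | zero => simp [hM0]
    | succ k ih =>
      rw [hT, hM]
      exact h.agree_pos ih
  have u0 : u 0 = z := by
    rw [← h.apply_pos 0, h.pos_zero]
  have u1 : u 1 = σ z := by
    have := h.apply_pos_succ 0
    rwa [h.pos_zero, u0] at this
  have count : ∀ k i j n, i < j → j < T (k + 1) → (∀ l < n, u (i + l) = u (j + l)) →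
      ∀ a, letterCount u a (i + n) ≤ letterCount u a i + letterCount u a (M k) := by
    intro k
    induction k with
    | zero =>
      intro i j n hij hj hn a
      have hp : pos 1 = 2 := by
        rw [h.pos_succ, h.pos_zero, u0, if_neg hz]
      rw [hT, hT0, hp] at hj
      obtain rfl : i = 0 := by omega
      obtain rfl : j = 1 := by omega
      rcases n with _ | n
      · simp
      · have := hn 0 (by omega)
        rw [u0, u1] at this
        exact absurd this.symm hz
    | succ k ih =>
      intro i j n hij hj hn a
      rw [hT] at hj
      rw [hM]
      exact h.letterCount_le_step ih hij hj hn a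
  have Tpos : 0 < T (k + 1) := by
    have : ∀ k, 0 < T k := by
      intro k
      induction k with
      | zero => omega
      | succ k ih =>
        rw [hT]
        exact ih.trans_le (h.strictMono.le_apply)
    exact this _
  constructor
  · intro i j hij hj he
    rw [factorAt_eq_iff] at he
    have h3 := Finset.sum_le_sum fun a (_ : a ∈ Finset.univ) => count k i j n hij hj he a
    rw [Finset.sum_add_distrib, sum_letterCount, sum_letterCount, sum_letterCount] at h3
    omega
  · intro m hm
    by_contra! hc
    refine hm 0 (T (k + 1)) Tpos hc (factorAt_eq_iff.2 fun l hl => ?_)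
    rw [zero_add]
    exact period (k + 1) l (by omega)

end IsSelfCoding

/-! ### The Fibonacci and Tribonacci words -/

theorem IsGreatest.inrC {A : Type*} {u : ℕ → A} {n m : ℕ}
    (h : IsGreatest (initialNonrepetitive u n) m) :
    IsGreatest (initialNonrepetitive u n) (inrC u n) ∧ inrC u n = m := by
  have e : _root_.inrC u n = m := h.csSup_eq
  exact ⟨e ▸ h, e⟩

theorem fibWord_isSelfCoding : IsSelfCoding fibWord 0 (· + 1)
    fun m => (applyMorphism fibMorphism (prefixOf fibWord m)).length :=
  fibWord_isFixedPointOf.isSelfCoding (by decide) (by decide)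

theorem tribWord_isSelfCoding : IsSelfCoding tribWord 0 (· + 1)
    fun m => (applyMorphism tribMorphism (prefixOf tribWord m)).length :=
  tribWord_isFixedPointOf.isSelfCoding (by decide) (by decide)

/-- Lengths of iterated images in the case of two letters. -/
theorem IsSelfCoding.iterate_fin_two {u : ℕ → Fin 2} {pos : ℕ → ℕ}
    (h : IsSelfCoding u 0 (· + 1) pos) {c : ℕ} (hc : c ≤ 1) {x : ℕ → ℕ}
    (hx : ∀ k, x (k + 1) = pos (x k) + c) (k : ℕ) :
    x (k + 2) = x (k + 1) + x k + 2 * c := by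
  -- The case `c = 0` serves `T` and `c = 1` serves `M`, whose final extra letter is a `0`.
  have e0 : ∀ k, letterCount u 0 (x (k + 1)) = x k + c := by
    intro k
    rw [hx]
    interval_cases c
    · exact h.letterCount_pos_self _
    · exact h.letterCount_pos_add_one_self _
  have e1 : ∀ k, letterCount u 1 (x (k + 1)) = letterCount u 0 (x k) := by
    intro k
    rw [hx]
    interval_cases c
    · exact h.letterCount_pos (b := 0) (by decide) _
    · exact h.letterCount_pos_add_one (b := 0) (by decide) _
  have s := sum_letterCount u (x (k + 2))
  rw [Fin.sum_univ_two, e0, e1, e0] at s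
  omega

/-- Lengths of iterated images in the case of three letters. -/
theorem IsSelfCoding.iterate_fin_three {u : ℕ → Fin 3} {pos : ℕ → ℕ}
    (h : IsSelfCoding u 0 (· + 1) pos) {c : ℕ} (hc : c ≤ 1) {x : ℕ → ℕ}
    (hx : ∀ k, x (k + 1) = pos (x k) + c) (k : ℕ) :
    x (k + 3) = x (k + 2) + x (k + 1) + x k + 3 * c := by
  have e0 : ∀ k, letterCount u 0 (x (k + 1)) = x k + c := by
    intro k
    rw [hx]
    interval_cases c
    · exact h.letterCount_pos_self _
    · exact h.letterCount_pos_add_one_self _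
  have e : ∀ (b : Fin 3) k, b + 1 ≠ 0 →
      letterCount u (b + 1) (x (k + 1)) = letterCount u b (x k) := by
    intro b k hb
    rw [hx]
    interval_cases c
    · exact h.letterCount_pos hb _
    · exact h.letterCount_pos_add_one hb _
  have s := sum_letterCount u (x (k + 3))
  have e1 := fun k => e 0 k (by decide)
  have e2 := fun k => e 1 k (by decide)
  simp only [zero_add, Fin.isValue, show (1 + 1 : Fin 3) = 2 from rfl] at e1 e2
  rw [Fin.sum_univ_three, e0, e1, e2, e1, e0, e0] at s
  omega

theorem fibNum_add_two (k : ℕ) : fibNum (k + 2) = fibNum (k + 1) + fibNum k := by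
  have := Nat.fib_add_two (n := k + 2)
  simp only [fibNum]
  rw [show k + 2 + 2 = (k + 2) + 2 from rfl, this, show k + 2 + 1 = k + 1 + 2 from rfl]
  omega

theorem isGreatest_fibWord {n k : ℕ} (h1 : fibNum (k + 1) < n + 2)
    (h2 : n + 2 ≤ fibNum (k + 2)) :
    IsGreatest (initialNonrepetitive fibWord n) (fibNum (k + 1)) := by
  have h := fibWord_isSelfCoding
  generalize (fun m => (applyMorphism fibMorphism (prefixOf fibWord m)).length) = pos at h
  let T : ℕ → ℕ := fun k => pos^[k] 1
  let M : ℕ → ℕ := fun k => (fun m => pos m + 1)^[k] 0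
  have hT : ∀ k, T (k + 1) = pos (T k) := fun k => Function.iterate_succ_apply' _ _ _
  have hM : ∀ k, M (k + 1) = pos (M k) + 1 := fun k => Function.iterate_succ_apply' _ _ _
  have hT0 : T 0 = 1 := rfl
  have hM0 : M 0 = 0 := rfl
  clear_value T M
  have u0 : fibWord 0 = 0 := rfl
  have p1 : pos 1 = 2 := by
    rw [h.pos_succ, h.pos_zero, u0, if_neg (by decide)]
  have Teq : ∀ k, T k = fibNum k := by
    intro k
    induction k using Nat.twoStepInduction with
    | zero => exact hT0
    | one => rw [hT, hT0, p1]; rfl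
    | more k ih1 ih2 =>
      rw [h.iterate_fin_two (c := 0) (by omega) hT, ih1, ih2, fibNum_add_two,
        mul_zero, add_zero]
  have Meq : ∀ k, M k + 2 = fibNum (k + 1) := by
    intro k
    induction k using Nat.twoStepInduction with
    | zero => rw [hM0]; rfl
    | one => rw [hM, hM0, h.pos_zero]; rfl
    | more k ih1 ih2 =>
      rw [h.iterate_fin_two (c := 1) (by omega) hM, fibNum_add_two]
      omega
  rw [← Teq]
  have := Meq k
  have := Meq (k + 1)
  exact h.isGreatest_initialNonrepetitive (by decide) hT0 hT hM0 hM (by omega)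
    (by rw [show k + 1 + 1 = k + 2 from rfl] at *; omega)

theorem isGreatest_tribWord {n k : ℕ}
    (h1 : tribNum ((k : ℤ) + 1) + tribNum ((k : ℤ) - 1) < 2 * n + 3)
    (h2 : 2 * n + 3 ≤ tribNum ((k : ℤ) + 2) + tribNum (k : ℤ)) :
    IsGreatest (initialNonrepetitive tribWord n) (tribNum ((k : ℤ) + 1)) := by
  have h := tribWord_isSelfCoding
  generalize (fun m => (applyMorphism tribMorphism (prefixOf tribWord m)).length) = pos at h
  let T : ℕ → ℕ := fun k => pos^[k] 1
  let M : ℕ → ℕ := fun k => (fun m => pos m + 1)^[k] 0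
  have hT : ∀ k, T (k + 1) = pos (T k) := fun k => Function.iterate_succ_apply' _ _ _
  have hM : ∀ k, M (k + 1) = pos (M k) + 1 := fun k => Function.iterate_succ_apply' _ _ _
  have hT0 : T 0 = 1 := rfl
  have hM0 : M 0 = 0 := rfl
  clear_value T M
  have u0 : tribWord 0 = 0 := rfl
  have p1 : pos 1 = 2 := by
    rw [h.pos_succ, h.pos_zero, u0, if_neg (by decide)]
  have u1 : tribWord 1 = 1 := by
    have := h.apply_pos_succ 0
    rwa [h.pos_zero, u0] at this
  have p2 : pos 2 = 4 := by
    rw [h.pos_succ, p1, u1, if_neg (by decide)]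
  have T1 : T 1 = 2 := by rw [hT, hT0, p1]
  have T2 : T 2 = 4 := by rw [hT, T1, p2]
  have M1 : M 1 = 1 := by rw [hM, hM0, h.pos_zero]
  have M2 : M 2 = 3 := by rw [hM, M1, p1]
  have Teq : ∀ k : ℕ, tribNumNat k = T k := by
    intro k
    induction k using Nat.strong_induction_on with
    | _ k ih =>
      match k with
      | 0 => exact hT0.symm
      | 1 => exact T1.symm
      | 2 => exact T2.symm
      | k + 3 =>
        rw [h.iterate_fin_three (c := 0) (by omega) hT, tribNumNat, ih k (by omega),
          ih (k + 1) (by omega), ih (k + 2) (by omega), mul_zero, add_zero]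
  have Meq : ∀ k : ℕ, 2 * M (k + 1) + 3 = T (k + 2) + T k := by
    intro k
    induction k using Nat.strong_induction_on with
    | _ k ih =>
      have rT := h.iterate_fin_three (c := 0) (by omega) hT
      have rM := h.iterate_fin_three (c := 1) (by omega) hM
      match k with
      | 0 => rw [zero_add, zero_add, M1, T2, hT0]
      | 1 =>
        have := rT 0
        simp only [zero_add, Nat.reduceAdd] at this ⊢
        omega
      | 2 =>
        have := rT 0
        have := rT 1
        have := rM 0
        simp only [zero_add, Nat.reduceAdd] at *
        omega
      | k + 3 =>
        have := ih k (by omega)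
        have := ih (k + 1) (by omega)
        have := ih (k + 2) (by omega)
        have := rT k
        have := rT (k + 2)
        have := rM (k + 1)
        simp only [add_assoc, Nat.reduceAdd] at *
        omega
  have cast : ∀ m : ℕ, tribNum (m : ℤ) = T m := Teq
  have e1 : tribNum ((k : ℤ) + 1) = T (k + 1) := cast (k + 1)
  have e2 : tribNum ((k : ℤ) + 2) = T (k + 2) := cast (k + 2)
  rw [e1] at h1 ⊢
  rw [e2, cast] at h2
  refine h.isGreatest_initialNonrepetitive (by decide) hT0 hT hM0 hM ?_
    (by have := Meq k; omega)
  -- `Meq` starts at `M 1`; the bound for `M 0 = 0` is where the value of `tribNum` at `-1` enters.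
  rcases k with _ | k
  · have : tribNum (((0 : ℕ) : ℤ) - 1) = 1 := rfl
    simp only [zero_add] at *
    omega
  · rw [show ((k + 1 : ℕ) : ℤ) - 1 = k by push_cast; ring, cast] at h1
    have := Meq k
    simp only [add_assoc, Nat.reduceAdd] at *
    omega

theorem corollary22 :
    (∀ n k : ℕ, 0 < n → 0 < k →
      (fibNum k : ℝ) - 2 < (n : ℝ) → (n : ℝ) ≤ (fibNum (k + 1) : ℝ) - 2 →
        IsGreatest (initialNonrepetitive fibWord n) (inrC fibWord n) ∧
          inrC fibWord n = fibNum k) ∧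
    (∀ n k : ℕ, 0 < n → 0 < k →
      ((tribNum (k : ℤ) : ℝ) + (tribNum ((k : ℤ) - 2) : ℝ) - 3) / 2 < (n : ℝ) →
      (n : ℝ) ≤ ((tribNum ((k : ℤ) + 1) : ℝ) + (tribNum ((k : ℤ) - 1) : ℝ) - 3) / 2 →
        IsGreatest (initialNonrepetitive tribWord n) (inrC tribWord n) ∧
          inrC tribWord n = tribNum (k : ℤ)) := by
  constructor
  · intro n k _ hk h1 h2
    obtain ⟨k, rfl⟩ := Nat.exists_eq_add_of_lt hk
    simp only [zero_add] at *
    refine (isGreatest_fibWord ?_ ?_).inrC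
    · have : (fibNum (k + 1) : ℝ) < n + 2 := by linarith
      exact_mod_cast this
    · have : (n : ℝ) + 2 ≤ fibNum (k + 1 + 1) := by linarith
      exact_mod_cast this
  · intro n k _ hk h1 h2
    obtain ⟨k, rfl⟩ := Nat.exists_eq_add_of_lt hk
    simp only [zero_add] at *
    rw [show ((k + 1 : ℕ) : ℤ) = (k : ℤ) + 1 by push_cast; rfl] at *
    rw [show (k : ℤ) + 1 - 2 = k - 1 by ring] at h1
    rw [show (k : ℤ) + 1 + 1 = k + 2 by ring, show (k : ℤ) + 1 - 1 = k by ring] at h2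
    refine (isGreatest_tribWord ?_ ?_).inrC
    · have : (tribNum ((k : ℤ) + 1) : ℝ) + tribNum ((k : ℤ) - 1) < 2 * n + 3 := by linarith
      exact_mod_cast this
    · have : 2 * (n : ℝ) + 3 ≤ tribNum ((k : ℤ) + 2) + tribNum (k : ℤ) := by linarith
      exact_mod_cast this
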